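/- Let $M$ be a monoid. A *right ideal* of $M$ is a (possibly empty) subset $\mathfrak a\subseteq M$ with $\mathfrak aM\subseteq\mathfrak a$; for $m\in M$ put $(\mathfrak a:m)=\{x\in M\mid mx\in\mathfrak a\}$. A *Grothendieck topology* on $M$ is a collection $\mathcal F$ of right ideals of $M$ such that (T1) $M\in\mathcal F$; (T2) if $\mathfrak a\in\mathcal F$ and $m\in M$, then $(\mathfrak a:m)\in\mathcal F$; (T3) if $\mathfrak b\in\mathcal F$ and $\mathfrak a$ is a right ideal with $(\mathfrak a:b)\in\mathcal F$ for every $b\in\mathfrak b$, then $\mathfrak a\in\mathcal F$. A *two-sided idempotent ideal* is a (possibly empty) subset $\mathfrak m\subseteq M$ with $M\mathfrak m\subseteq\mathfrak m$, $\mathfrak mM\subseteq\mathfrak m$ and $\mathfrak m=\mathfrak m^2=\{yz\mid y,z\in\mathfrak m\}$. Let $\mathcal F_{\mathfrak m}$ be the set of all right ideals of $M$ that contain $\mathfrak m$. Let $\mathsf{Sets}_M$ be the category of right $M$-sets. For a collection $\mathcal F$ of right ideals, a right $M$-set $A$ is an *$\mathcal F$-sheaf* if for every $\mathfrak a\in\mathcal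 F$ the map $A\to\mathrm{Hom}_M(\mathfrak a,A)$, $s\mapsto(x\mapsto sx)$, is bijective; $\mathbf{Sh}(\mathcal F)$ is the full subcategory of $\mathcal F$-sheaves. A *localising subcategory* of $\mathsf{Sets}_M$ is a full subcategory that is closed under isomorphism and whose inclusion has a left adjoint preserving finite limits. 1. For every monoid $M$ and every two-sided idempotent ideal $\mathfrak m$ of $M$, the set $\mathcal F_{\mathfrak m}$ is a Grothendieck topology on $M$. 2. If $M$ is finite, then for every Grothendieck topology $\mathcal F$ on $M$ there is a unique two-sided idempotent ideal $\mathfrak m$ with $\mathcal F=\mathcal F_{\mathfrak m}$. 3. If $M$ is finite, then $\mathfrak m\mapsto\mathbf{Sh}(\mathcal F_{\mathfrak m})$ is a bijection from the set of two-sided idempotent ideals of $M$ onto the set of localising subcategories of $\mathsf{Sets}_M$, and it is an isomorphism of posets when both sets are ordered by inclusion. -/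

import Mathlib

open CategoryTheory CategoryTheory.Limits
open scoped Pointwise

universe u

namespace MonoidTopos

/-- A right ideal of a monoid `M`: a subset (possibly empty) stable under right multiplication,
i.e. a subobject of `M` regarded as a right `M`-set (a right action is an action of `Mᵐᵒᵖ`). -/
abbrev RightIdeal (M : Type u) [Monoid M] : Type u := SubMulAction Mᵐᵒᵖ M

theorem RightIdeal.mul_mem {M : Type u} [Monoid M] (a : RightIdeal M) {x : M} (hx : x ∈ a)
    (m : M) : x * m ∈ a :=
  a.smul_mem (MulOpposite.op m) hx

/-- The right ideal `(a : m) = {x ∈ M | m x ∈ a}`. -/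
def RightIdeal.colon {M : Type u} [Monoid M] (a : RightIdeal M) (m : M) : RightIdeal M where
  carrier := {x | m * x ∈ a}
  smul_mem' c x hx := by
    change m * (x * c.unop) ∈ a
    rw [← mul_assoc]
    exact a.mul_mem hx c.unop

/-- A Grothendieck topology on a monoid `M`: a collection of right ideals satisfying the three
usual axioms. -/
structure IsGrothendieckTopology {M : Type u} [Monoid M] (F : Set (RightIdeal M)) : Prop where
  top_mem : (⊤ : RightIdeal M) ∈ F
  colon_mem : ∀ a ∈ F, ∀ m : M, a.colon m ∈ F
  transitive : ∀ b ∈ F, ∀ a : RightIdeal M, (∀ x ∈ b, a.colon x ∈ F) → a ∈ F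

/-- A two-sided ideal of a monoid (possibly empty). -/
def IsTwoSidedIdeal {M : Type u} [Monoid M] (I : Set M) : Prop :=
  ∀ z ∈ I, ∀ x : M, x * z ∈ I ∧ z * x ∈ I

/-- A two-sided ideal `I` with `I ^ 2 = I`, where `I * I = {y z | y, z ∈ I}`. -/
def IsIdempotentIdeal {M : Type u} [Monoid M] (I : Set M) : Prop :=
  IsTwoSidedIdeal I ∧ I * I = I

/-- The set of right ideals of `M` that contain the subset `I`. -/
def idealsContaining {M : Type u} [Monoid M] (I : Set M) : Set (RightIdeal M) :=
  {a | I ⊆ (a : Set M)}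

/-- The category of right `M`-sets, as presheaves of sets on the category with one object and
monoid of endomorphisms `M`; the morphisms (natural transformations) are the equivariant maps. -/
abbrev RightSets (M : Type u) [Monoid M] : Type (u + 1) := (SingleObj M)ᵒᵖ ⥤ Type u

/-- The underlying set of a right `M`-set. -/
abbrev RightSets.carrier {M : Type u} [Monoid M] (A : RightSets M) : Type u :=
  A.obj (Opposite.op (SingleObj.star M))

/-- The right action of `M` on a right `M`-set: `A.act x m` is `x · m`. -/
def RightSets.act {M : Type u} [Monoid M] (A : RightSets M) (x : A.carrier) (m : M) : A.carrier :=
  A.map (Quiver.Hom.op (X := SingleObj.star M) (Y := SingleObj.star M) m) x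

theorem RightSets.act_one {M : Type u} [Monoid M] (A : RightSets M) (x : A.carrier) :
    A.act x 1 = x := by
  have h := A.map_id (Opposite.op (SingleObj.star M))
  exact congrArg (fun f => f x) h

theorem RightSets.act_mul {M : Type u} [Monoid M] (A : RightSets M) (x : A.carrier) (m n : M) :
    A.act x (m * n) = A.act (A.act x m) n := by
  have h := A.map_comp
    (Quiver.Hom.op (X := SingleObj.star M) (Y := SingleObj.star M) m)
    (Quiver.Hom.op (X := SingleObj.star M) (Y := SingleObj.star M) n)
  exact congrArg (fun f => f x) h

/-- The set `Hom_M(a, A)` of maps of right `M`-sets from a right ideal `a` to `A`. -/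
def HomFromIdeal {M : Type u} [Monoid M] (a : RightIdeal M) (A : RightSets M) : Type u :=
  {f : a → A.carrier // ∀ (x : a) (m : M), f ⟨x * m, a.mul_mem x.2 m⟩ = A.act (f x) m}

/-- The restriction map `A → Hom_M(a, A)`, `s ↦ (x ↦ s · x)`. -/
def restrictToIdeal {M : Type u} [Monoid M] (a : RightIdeal M) (A : RightSets M)
    (s : A.carrier) : HomFromIdeal a A :=
  ⟨fun x => A.act s x, fun x m => A.act_mul s x m⟩

/-- The full subcategory of sheaves for a collection `F` of right ideals, as a property of
right `M`-sets. -/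
def sheaves {M : Type u} [Monoid M] (F : Set (RightIdeal M)) : ObjectProperty (RightSets M) :=
  fun A => ∀ a ∈ F, Function.Bijective (restrictToIdeal a A)

/-- A full subcategory `P` of `E` is localising: it is closed under isomorphisms and its inclusion
has a left adjoint that preserves finite limits. -/
structure IsLocalising {E : Type*} [Category* E] (P : ObjectProperty E) : Prop where
  closedUnderIso : P.IsClosedUnderIsomorphisms
  exists_localisation : ∃ ρ : E ⥤ P.FullSubcategory,
    Nonempty (ρ ⊣ P.ι) ∧ PreservesFiniteLimits ρ

/-- The poset of two-sided idempotent ideals of `M`, ordered by inclusion. -/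
abbrev IdempotentIdeals (M : Type u) [Monoid M] : Type u :=
  {I : Set M // IsIdempotentIdeal I}

/-- The poset of localising subcategories of `E`, ordered by inclusion. -/
abbrev Loc (E : Type*) [Category* E] := {P : ObjectProperty E // IsLocalising P}

end MonoidTopos

namespace MonoidTopos

/-! ### Localising subcategories of presheaves are sheaf categories -/

section Presheaves

universe w

variable {C : Type w} [Category.{u} C] {P : ObjectProperty (Cᵒᵖ ⥤ Type u)}

/-! A topology `F` on a finite monoid is closed under finite intersections, so it has a least member
`m` and equals the set of right ideals containing `m`; (T2) makes `m` two-sided and (T3) makes it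
idempotent.

Both `m ↦ F_m` and `F ↦ Sh(F)` reverse inclusions, so their composite preserves them. Surjectivity
rests on `isSheaf_finestTopology_iff`: a localising `P` consists of the sheaves for the finest
topology making every object of `P` a sheaf. Left exactness of the reflector makes `P`-local maps
stable under pullback, hence locally bijective for this topology; the reflection unit at a sheaf is
then an isomorphism. -/

theorem isLocal_of_isPullback {E : Type*} [Category* E] {P : ObjectProperty E}
    (hP : IsLocalising P) {X Y Z W : E} {t : X ⟶ Y} {l : X ⟶ Z} {r : Y ⟶ W} {b : Z ⟶ W}
    (h : IsPullback t l r b) (hr : P.isLocal r) : P.isLocal l := by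
  obtain ⟨ρ, ⟨adj⟩, _⟩ := hP.exists_localisation
  have hrange : (· ∈ Set.range P.ι.obj) = P := by
    ext X
    exact ⟨by rintro ⟨Y, rfl⟩; exact Y.property, fun hX => ⟨⟨X, hX⟩, rfl⟩⟩
  have key : ∀ {X Y : E} (f : X ⟶ Y), P.isLocal f ↔ IsIso (ρ.map f) := fun f => by
    have := ObjectProperty.isLocal_iff_isIso_map adj f
    rwa [hrange] at this
  rw [key] at hr ⊢
  exact (h.map ρ).isIso_snd_of_isIso

/-- This turns locality of a mono into a sheaf condition: a sieve inclusion is local exactly when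
every object of `P` is a sheaf for that sieve. -/
theorem isPullback_functorInclusion_imageSieve {X Y : Cᵒᵖ ⥤ Type u} (i : X ⟶ Y) [Mono i] {U : C}
    (y : Y.obj (Opposite.op U)) :
    ∃ t : (Presheaf.imageSieve i y).functor ⟶ X,
      IsPullback t (Presheaf.imageSieve i y).functorInclusion i (yonedaEquiv.symm y) := by
  have hi : ∀ V, Function.Injective (i.app V) := fun V => by
    rw [← mono_iff_injective]; infer_instance
  refine ⟨{ app V := ↾fun g => g.2.choose, naturality V W f := ?_ }, ?_⟩
  · ext g
    apply hi
    have h₁ := ((Presheaf.imageSieve i y).functor.map f g).2.choose_spec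
    have h₂ := g.2.choose_spec
    refine h₁.trans ?_
    have := NatTrans.naturality_apply i f g.2.choose
    refine Eq.trans ?_ this.symm
    refine Eq.trans ?_ (congrArg (Y.map f) h₂).symm
    exact Y.map_comp_apply g.1.op f y
  · refine .of_forall_isPullback_app fun V => ?_
    rw [Types.isPullback_iff]
    refine ⟨?_, ?_, ?_⟩
    · ext g
      exact g.2.choose_spec
    · rintro g h ⟨-, e⟩
      exact Subtype.ext e
    · intro x g e
      refine ⟨⟨g, x, e⟩, hi _ ?_, rfl⟩
      exact (Exists.choose_spec (⟨x, e⟩ : ∃ x, i.app _ x = Y.map g.op y)).trans e.symm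

/-- Monomorphisms inverted by the reflector onto a localising subcategory are locally surjective
for the finest topology whose sheaves include the subcategory. -/
theorem isLocallySurjective_of_isLocal (hP : IsLocalising P) {X Y : Cᵒᵖ ⥤ Type u} (i : X ⟶ Y)
    [Mono i] (hi : P.isLocal i) :
    Presheaf.IsLocallySurjective (Sheaf.finestTopology {A | P A}) i where
  imageSieve_mem {U} s := by
    -- A sieve covers for the finest topology once the sheaf condition holds for all its pullbacks,
    -- which are again image sieves.
    refine Sheaf.mem_finestTopology_of_forall_isSheafFor fun A hA V f => ?_
    rw [Presheaf.pullback_imageSieve, Presieve.isSheafFor_iff_yonedaSheafCondition]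
    obtain ⟨t, ht⟩ := isPullback_functorInclusion_imageSieve i (Y.map f.op s)
    intro g
    exact (isLocal_of_isPullback hP ht hi A hA).existsUnique g

/-- The diagonal of `f` is a section of a pullback of `f`, hence a local mono. Its local
surjectivity says that sections identified by `f` agree locally. -/
theorem isLocallyInjective_of_isLocal (hP : IsLocalising P) {X Y : Cᵒᵖ ⥤ Type u} (f : X ⟶ Y)
    (hf : P.isLocal f) :
    Presheaf.IsLocallyInjective (Sheaf.finestTopology {A | P A}) f where
  equalizerSieve_mem {U} x y h := by
    have hfst : P.isLocal (pullback.fst f f) :=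
      isLocal_of_isPullback hP (IsPullback.of_hasPullback f f).flip hf
    have hd : P.isLocal (pullback.diagonal f) := by
      refine P.isLocal.of_postcomp (pullback.diagonal f) _ hfst ?_
      rw [pullback.diagonal_fst]
      exact P.isLocal_of_isIso _
    have := isLocallySurjective_of_isLocal hP _ hd
    have hpb := (IsPullback.of_hasPullback f f).app U
    obtain ⟨z, hz₁, hz₂⟩ := Types.exists_of_isPullback hpb x y h
    refine GrothendieckTopology.superset_covering _ ?_
      (Presheaf.imageSieve_mem (Sheaf.finestTopology {A | P A}) (pullback.diagonal f) z)
    rintro V g ⟨a, ha⟩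
    have e₁ := congrArg ((pullback.fst f f).app _) ha
    have e₂ := congrArg ((pullback.snd f f).app _) ha
    have d₁ : (pullback.fst f f).app _ ((pullback.diagonal f).app _ a) = a :=
      ConcreteCategory.congr_hom (NatTrans.congr_app (pullback.diagonal_fst f) _) a
    have d₂ : (pullback.snd f f).app _ ((pullback.diagonal f).app _ a) = a :=
      ConcreteCategory.congr_hom (NatTrans.congr_app (pullback.diagonal_snd f) _) a
    rw [NatTrans.naturality_apply, hz₁] at e₁
    rw [NatTrans.naturality_apply, hz₂] at e₂
    exact (e₁.symm.trans (d₁.trans d₂.symm)).trans e₂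

theorem isSheaf_finestTopology_iff (hP : IsLocalising P) (A : Cᵒᵖ ⥤ Type u) :
    Presieve.IsSheaf (Sheaf.finestTopology {A | P A}) A ↔ P A := by
  refine ⟨fun hA => ?_, fun hA => Sheaf.sheaf_for_finestTopology _ hA⟩
  obtain ⟨ρ, ⟨adj⟩, _⟩ := hP.exists_localisation
  set J := Sheaf.finestTopology {A | P A}
  let η : A ⟶ (ρ.obj A).obj := adj.unit.app A
  have hloc : P.isLocal η := fun Z hZ =>
    ObjectProperty.isLocal_adj_unit_app adj A Z ⟨⟨Z, hZ⟩, rfl⟩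
  have hB : Presieve.IsSheaf J (ρ.obj A).obj :=
    Sheaf.sheaf_for_finestTopology _ (ρ.obj A).property
  have hinj := isLocallyInjective_of_isLocal hP _ hloc
  have : ∀ U, Function.Injective (η.app U) := fun U x y h => by
    refine (hA _ (Presheaf.equalizerSieve_mem J η x y h)).isSeparatedFor.ext fun _ _ hg => ?_
    exact hg
  have : Mono η := by
    rw [NatTrans.mono_iff_mono_app]
    exact fun U => (mono_iff_injective _).2 (this U)
  have hsurj := isLocallySurjective_of_isLocal hP _ hloc
  have : IsIso η := by
    let φ : (⟨A, (isSheaf_iff_isSheaf_of_type _ _).2 hA⟩ : Sheaf J (Type u)) ⟶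
      ⟨_, (isSheaf_iff_isSheaf_of_type _ _).2 hB⟩ := ⟨η⟩
    have : IsIso φ := (Sheaf.isLocallyBijective_iff_isIso φ).1 ⟨hinj, hsurj⟩
    exact inferInstanceAs (IsIso ((sheafToPresheaf J _).map φ))
  have := hP.closedUnderIso
  exact P.prop_of_iso (asIso η).symm (ρ.obj A).property

end Presheaves

/-! ### Topologies on a monoid and their sheaves -/

section Monoids

variable {M : Type u} [Monoid M]

/-- Right ideals of `M` are the same as sieves on the object of the category attached to `M`. -/
def RightIdeal.sieveEquiv (X : SingleObj M) : RightIdeal M ≃ Sieve X where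
  toFun a :=
    { arrows _ f := (show M from f) ∈ a
      downward_closed hf g := a.mul_mem hf g }
  invFun S :=
    { carrier := {x | S.arrows (Y := X) x}
      smul_mem' c _ hx := S.downward_closed (Z := X) hx c.unop }
  left_inv _ := rfl
  right_inv _ := rfl

theorem bijective_restrictToIdeal_iff (a : RightIdeal M) (X : SingleObj M) (A : RightSets M) :
    Function.Bijective (restrictToIdeal a A) ↔
      Presieve.IsSheafFor A (RightIdeal.sieveEquiv X a).arrows := by
  rw [Function.bijective_iff_existsUnique]
  constructor
  · intro h x hx
    rw [Presieve.compatible_iff_sieveCompatible] at hx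
    obtain ⟨s, hs, hs'⟩ := h ⟨fun m => x (Y := SingleObj.star M) m.1 m.2, fun m n =>
      hx (Y := SingleObj.star M) (Z := SingleObj.star M) m.1 n m.2⟩
    refine ⟨s, fun Y f hf => congrFun (congrArg Subtype.val hs) ⟨f, hf⟩, fun t ht => hs' t ?_⟩
    exact Subtype.ext (funext fun m => ht (Y := SingleObj.star M) m.1 m.2)
  · intro h f
    obtain ⟨s, hs, hs'⟩ := h (fun Y m hm => f.1 ⟨m, hm⟩) ((Presieve.compatible_iff_sieveCompatible _).2
      fun Y Z m n hm => f.2 ⟨m, hm⟩ n)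
    refine ⟨s, ?_, fun t ht => hs' t fun Y m hm => congrFun (congrArg Subtype.val ht) ⟨m, hm⟩⟩
    exact Subtype.ext (funext fun m => hs (Y := SingleObj.star M) m.1 m.2)

/-- The topology on the one-object category attached to `M` given by a Grothendieck topology
on `M`. -/
def IsGrothendieckTopology.topology {F : Set (RightIdeal M)} (hF : IsGrothendieckTopology F) :
    GrothendieckTopology (SingleObj M) where
  sieves X := {S | (RightIdeal.sieveEquiv X).symm S ∈ F}
  top_mem' _ := hF.top_mem
  pullback_stable' _ _ _ f hS := hF.colon_mem _ hS f
  transitive' X _ hS _ hR := hF.transitive _ hS _ fun x hx => hR (Y := X) (f := x) hx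

theorem IsGrothendieckTopology.sieveEquiv_mem_topology_iff {F : Set (RightIdeal M)}
    (hF : IsGrothendieckTopology F) (X : SingleObj M) (a : RightIdeal M) :
    RightIdeal.sieveEquiv X a ∈ hF.topology X ↔ a ∈ F :=
  Iff.rfl

theorem IsGrothendieckTopology.isSheaf_topology_iff {F : Set (RightIdeal M)}
    (hF : IsGrothendieckTopology F) (A : RightSets M) :
    Presieve.IsSheaf hF.topology A ↔ sheaves F A := by
  constructor
  · intro h a ha
    exact (bijective_restrictToIdeal_iff a (SingleObj.star M) A).2
      (h _ ((hF.sieveEquiv_mem_topology_iff _ a).2 ha))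
  · intro h X S hS
    exact (bijective_restrictToIdeal_iff _ X A).1 (h _ hS)

/-- The covering right ideals of a topology on the one-object category attached to `M`. -/
def coveringIdeals (J : GrothendieckTopology (SingleObj M)) : Set (RightIdeal M) :=
  {a | RightIdeal.sieveEquiv (SingleObj.star M) a ∈ J (SingleObj.star M)}

theorem isGrothendieckTopology_coveringIdeals (J : GrothendieckTopology (SingleObj M)) :
    IsGrothendieckTopology (coveringIdeals J) where
  top_mem := J.top_mem _
  colon_mem _ ha m := J.pullback_stable (Y := SingleObj.star M) m ha
  transitive _ hb _ h := J.transitive hb _ fun _ f hf => h f hf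

theorem topology_coveringIdeals (J : GrothendieckTopology (SingleObj M)) :
    (isGrothendieckTopology_coveringIdeals J).topology = J :=
  rfl

theorem IsGrothendieckTopology.sheaves_le_sheaves_iff {F G : Set (RightIdeal M)}
    (hF : IsGrothendieckTopology F) (hG : IsGrothendieckTopology G) :
    sheaves F ≤ sheaves G ↔ G ⊆ F := by
  refine ⟨fun h a ha => ?_, fun h A hA a ha => hA a (h ha)⟩
  -- The presheaf of `F`-closed sieves is an `F`-sheaf; being also a `G`-sheaf forces every
  -- `G`-cover to be an `F`-cover.
  have hle : hG.topology ≤ hF.topology :=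
    le_topology_of_closedSieves_isSheaf ((hG.isSheaf_topology_iff _).2
      (h _ ((hF.isSheaf_topology_iff _).1 (classifier_isSheaf hF.topology))))
  exact hle (SingleObj.star M) ((hG.sieveEquiv_mem_topology_iff _ a).2 ha)

theorem IsGrothendieckTopology.isLocalising_sheaves {F : Set (RightIdeal M)}
    (hF : IsGrothendieckTopology F) : IsLocalising (sheaves F) := by
  have h : sheaves F = Presheaf.IsSheaf hF.topology := by
    ext A
    rw [isSheaf_iff_isSheaf_of_type, hF.isSheaf_topology_iff]
  rw [h]
  exact ⟨⟨fun e hA => (Presheaf.isSheaf_of_iso_iff e).1 hA⟩,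
    presheafToSheaf hF.topology (Type u), ⟨sheafificationAdjunction _ _⟩, inferInstance⟩

theorem IsLocalising.exists_eq_sheaves {P : ObjectProperty (RightSets M)} (hP : IsLocalising P) :
    ∃ F : Set (RightIdeal M), IsGrothendieckTopology F ∧ P = sheaves F := by
  have hF := isGrothendieckTopology_coveringIdeals (Sheaf.finestTopology {A | P A})
  refine ⟨_, hF, ?_⟩
  ext A
  rw [← hF.isSheaf_topology_iff, topology_coveringIdeals, isSheaf_finestTopology_iff hP]

/-! ### Idempotent ideals and topologies on a finite monoid -/

theorem isGrothendieckTopology_idealsContaining {I : Set M} (hI : IsIdempotentIdeal I) :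
    IsGrothendieckTopology (idealsContaining I) where
  top_mem _ _ := trivial
  colon_mem _ ha m x hx := ha (hI.1 x hx m).1
  transitive b hb a h z hz := by
    rw [← hI.2] at hz
    obtain ⟨x, hx, y, hy, rfl⟩ := hz
    exact h x (hb hx) hy

/-- A two-sided ideal, regarded as a right ideal. -/
def IsTwoSidedIdeal.toRightIdeal {I : Set M} (hI : IsTwoSidedIdeal I) : RightIdeal M where
  carrier := I
  smul_mem' c x hx := (hI x hx c.unop).2

theorem idealsContaining_subset_idealsContaining_iff {I J : Set M} (hI : IsTwoSidedIdeal I) :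
    idealsContaining I ⊆ idealsContaining J ↔ J ⊆ I :=
  ⟨fun h => h (show hI.toRightIdeal ∈ idealsContaining I from fun _ hx => hx),
    fun h _ ha => h.trans ha⟩

namespace IsGrothendieckTopology

variable {F : Set (RightIdeal M)} (hF : IsGrothendieckTopology F)
include hF

theorem mem_of_le {a b : RightIdeal M} (ha : a ∈ F) (h : a ≤ b) : b ∈ F := by
  refine hF.transitive a ha b fun x hx => ?_
  have : b.colon x = ⊤ := eq_top_iff.2 fun y _ => b.mul_mem (h hx) y
  exact this ▸ hF.top_mem

theorem inf_mem {a b : RightIdeal M} (ha : a ∈ F) (hb : b ∈ F) : a ⊓ b ∈ F := by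
  refine hF.transitive a ha _ fun x hx => hF.mem_of_le (hF.colon_mem b hb x) fun y hy => ?_
  exact ⟨a.mul_mem hx y, hy⟩

theorem sInf_mem [Finite M] : sInf F ∈ F := by
  have : Finite (RightIdeal M) := Finite.of_injective _ SetLike.coe_injective
  have key : ∀ s : Set (RightIdeal M), s.Finite → s ⊆ F → sInf s ∈ F := fun s hs => by
    induction s, hs using Set.Finite.induction_on with
    | empty => exact fun _ => by simpa using hF.top_mem
    | insert _ _ ih =>
      intro h
      rw [sInf_insert]
      exact hF.inf_mem (h (Set.mem_insert _ _)) (ih ((Set.subset_insert _ _).trans h))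
  exact key F F.toFinite subset_rfl

theorem exists_eq_idealsContaining [Finite M] :
    ∃ I : Set M, IsIdempotentIdeal I ∧ F = idealsContaining I := by
  have hm := hF.sInf_mem
  have hI : IsTwoSidedIdeal ((sInf F : RightIdeal M) : Set M) := fun z hz x =>
    -- By (T2), `(m : x)` is in `F`, so it contains the least member `m`.
    ⟨sInf_le (hF.colon_mem _ hm x) hz, (sInf F : RightIdeal M).mul_mem hz x⟩
  refine ⟨(sInf F : RightIdeal M), ⟨hI, subset_antisymm ?_ ?_⟩, ?_⟩
  · rintro _ ⟨y, hy, z, -, rfl⟩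
    exact (hI y hy z).2
  · let sq : RightIdeal M :=
      { carrier := (sInf F : RightIdeal M) * (sInf F : RightIdeal M)
        smul_mem' := by
          rintro c _ ⟨y, hy, z, hz, rfl⟩
          exact ⟨y, hy, z * c.unop, (hI z hz _).2, (mul_assoc _ _ _).symm⟩ }
    -- For `x ∈ m`, the ideal `(m² : x)` contains `m`; so (T3) puts `m²` in `F`, above the least
    -- member.
    exact sInf_le (a := sq) (hF.transitive _ hm sq fun x hx =>
      hF.mem_of_le hm fun y hy => ⟨x, hx, y, hy, rfl⟩)
  · exact subset_antisymm (fun a ha => sInf_le ha) fun a ha => hF.mem_of_le hm ha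

end IsGrothendieckTopology

/-- A two-sided idempotent ideal gives the localising subcategory of sheaves for the topology
of right ideals containing it. -/
def IdempotentIdeals.toLoc : IdempotentIdeals M ↪o Loc (RightSets M) :=
  OrderEmbedding.ofMapLEIff
    (fun I => ⟨sheaves (idealsContaining I.1),
      (isGrothendieckTopology_idealsContaining I.2).isLocalising_sheaves⟩)
    fun I J => ((isGrothendieckTopology_idealsContaining I.2).sheaves_le_sheaves_iff
      (isGrothendieckTopology_idealsContaining J.2)).trans
        (idealsContaining_subset_idealsContaining_iff J.2.1)

theorem IdempotentIdeals.toLoc_surjective [Finite M] :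
    Function.Surjective (toLoc (M := M)) := by
  rintro ⟨P, hP⟩
  obtain ⟨F, hF, rfl⟩ := hP.exists_eq_sheaves
  obtain ⟨I, hI, rfl⟩ := hF.exists_eq_idealsContaining
  exact ⟨⟨I, hI⟩, rfl⟩

end Monoids

end MonoidTopos

theorem proposition422p08 :
    (∀ (M : Type u) [Monoid M] (I : Set M), MonoidTopos.IsIdempotentIdeal I →
      MonoidTopos.IsGrothendieckTopology (MonoidTopos.idealsContaining I)) ∧
    (∀ (M : Type u) [Monoid M] [Finite M],
      (∀ F : Set (MonoidTopos.RightIdeal M), MonoidTopos.IsGrothendieckTopology F →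
        ∃! I : Set M, MonoidTopos.IsIdempotentIdeal I ∧ F = MonoidTopos.idealsContaining I) ∧
      ∃ Φ : MonoidTopos.IdempotentIdeals M ≃o MonoidTopos.Loc (MonoidTopos.RightSets M),
        ∀ I : MonoidTopos.IdempotentIdeals M,
          (Φ I).1 = MonoidTopos.sheaves (MonoidTopos.idealsContaining I.1)) := by
  refine ⟨fun M _ I hI => MonoidTopos.isGrothendieckTopology_idealsContaining hI,
    fun M _ _ => ⟨fun F hF => ?_, ?_⟩⟩
  · obtain ⟨I, hI, rfl⟩ := hF.exists_eq_idealsContaining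
    refine ⟨I, ⟨hI, rfl⟩, fun J ⟨hJ, h⟩ => subset_antisymm ?_ ?_⟩
    · exact (MonoidTopos.idealsContaining_subset_idealsContaining_iff hI.1).1 h.subset
    · exact (MonoidTopos.idealsContaining_subset_idealsContaining_iff hJ.1).1 h.superset
  · exact ⟨RelIso.ofSurjective MonoidTopos.IdempotentIdeals.toLoc
      MonoidTopos.IdempotentIdeals.toLoc_surjective, fun I => rfl⟩
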